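/- Strings are finite sequences over an integer alphabet. A border of a string $T$ is a non-empty string that is both a proper prefix and a proper suffix of $T$. A block palindrome of $T$ is a factorization $T = f_{-n}\cdots f_{-1} f_0 f_1 \cdots f_n$, $n \ge 0$, in which $f_{-i} = f_i$ is non-empty for $1 \le i \le n$ and the center block $f_0$ may be empty; its size is its number of non-empty blocks. A largest block palindrome of $T$ is a block palindrome of $T$ of maximum size. Theorem 1. Every string $T$ has exactly one largest block palindrome. A block palindrome $f_{-n}\cdots f_n$ of $T$ is the largest one if and only if, for every $1 \le i \le n$, the block $f_i$ is the shortest border of $f_{-i}\cdots f_i$, and $f_0$ has no border. Moreover, the largest block palindrome of a string $T$ of length $N$ can be computed in $O(N)$ time on a word RAM: there are a single program and constants $a, C$ such that, for every word size $w$ with $a(N+1) \le 2^w$ and every $T$ of length $N$ whose characters are integers in $[0, 2^w)$, the program with $w$-bit words, given $T$ in memory and $N$ in a register, stops after at most $C(N+1)$ steps having output the lengths $|f_{-n}|, \ldots, |f_n|$ of the blocks of the largest block palindrome of $T$, from left to right. -/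

import Mathlib

/-! ## Strings, borders, block palindromes -/

/-- `x` is a border of `T`: a non-empty proper prefix of `T` that is also a suffix of `T`. -/
def IsBorder {α : Type*} (x T : List α) : Prop :=
  x ≠ [] ∧ x ≠ T ∧ x <+: T ∧ x <:+ T

/-- `T` has no border. -/
def Unbordered {α : Type*} (T : List α) : Prop :=
  ∀ x : List α, ¬ IsBorder x T

/-- `x` is the shortest border of `T`. -/
def IsShortestBorder {α : Type*} (x T : List α) : Prop :=
  IsBorder x T ∧ ∀ y : List α, IsBorder y T → x.length ≤ y.length

/-- A symmetric factorization `f₋ₙ ⋯ f₋₁ f₀ f₁ ⋯ fₙ` with `f₋ᵢ = fᵢ ≠ ε` for `1 ≤ i ≤ n`; the centre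
`f₀` may be empty. The list `arms` is `[f₁, …, fₙ]`. -/
structure BlockPalindrome (α : Type*) where
  /-- the centre block `f₀` -/
  center : List α
  /-- the blocks `[f₁, …, fₙ]`, from the centre outward -/
  arms : List (List α)
  arms_ne_nil : ∀ b ∈ arms, b ≠ []

namespace BlockPalindrome

variable {α : Type*}

/-- The blocks from left to right: `[f₋ₙ, …, f₋₁, f₀, f₁, …, fₙ]`. -/
def blocks (f : BlockPalindrome α) : List (List α) :=
  f.arms.reverse ++ f.center :: f.arms

/-- The string that is factorized. -/
def word (f : BlockPalindrome α) : List α :=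
  f.blocks.flatten

/-- The number of non-empty blocks. -/
def size (f : BlockPalindrome α) : ℕ :=
  f.blocks.countP (fun b => !b.isEmpty)

/-- `f` is a block palindrome of `T` with the largest number of blocks. -/
def IsLargest (f : BlockPalindrome α) (T : List α) : Prop :=
  f.word = T ∧ ∀ g : BlockPalindrome α, g.word = T → g.size ≤ f.size

/-- The substring `f₋ᵢ ⋯ f₋₁ f₀ f₁ ⋯ fᵢ`. -/
def core (f : BlockPalindrome α) (i : ℕ) : List α :=
  ((f.arms.take i).reverse ++ f.center :: f.arms.take i).flatten

/-- `f` arises by peeling off shortest borders from the outside inward: every `fᵢ`, `1 ≤ i ≤ n`, is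
the shortest border of `f₋ᵢ ⋯ fᵢ`, and the centre `f₀` that is left has no border. -/
def IsGreedy (f : BlockPalindrome α) : Prop :=
  Unbordered f.center ∧
    ∀ (i : ℕ) (h : i < f.arms.length), IsShortestBorder f.arms[i] (f.core (i + 1))

end BlockPalindrome

/-! ## The word RAM

Registers and memory cells hold `w`-bit words (natural numbers below `2 ^ w`), arithmetic is modulo
`2 ^ w`, memory is addressed by words, and every instruction costs one time unit. A program is a
finite list of instructions that does not depend on `w`. Multiplication, division and bitwise
operations are not offered, so a program here is also a program of any richer word RAM. -/

namespace WordRAM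

/-- Instructions; arguments named `d`, `a`, `b` are register numbers. -/
inductive Instr where
  /-- `r_d := k` -/
  | const (d k : ℕ)
  /-- `r_d := r_a` -/
  | copy (d a : ℕ)
  /-- `r_d := r_a + r_b` -/
  | add (d a b : ℕ)
  /-- `r_d := r_a - r_b` -/
  | sub (d a b : ℕ)
  /-- `r_d := mem[r_a]` -/
  | load (d a : ℕ)
  /-- `mem[r_a] := r_b` -/
  | store (a b : ℕ)
  /-- continue at instruction `l` -/
  | jump (l : ℕ)
  /-- continue at instruction `l` if `r_a = r_b` -/
  | jumpEq (a b l : ℕ)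
  /-- continue at instruction `l` if `r_a < r_b` -/
  | jumpLt (a b l : ℕ)
  /-- append `r_a` to the output -/
  | write (a : ℕ)
  /-- stop -/
  | halt

/-- A configuration: program counter, registers, memory, and the output written so far. -/
structure Config where
  pc : ℕ
  reg : ℕ → ℕ
  mem : ℕ → ℕ
  output : List ℕ

/-- One step on words of `w` bits. The machine stops (`none`) at `halt` and when the program counter
leaves the program. -/
def step (w : ℕ) (P : List Instr) (s : Config) : Option Config :=
  match P[s.pc]? with
  | none => none
  | some .halt => none
  | some (.const d k) =>
      some { s with pc := s.pc + 1, reg := Function.update s.reg d (k % 2 ^ w) }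
  | some (.copy d a) =>
      some { s with pc := s.pc + 1, reg := Function.update s.reg d (s.reg a) }
  | some (.add d a b) =>
      some { s with
        pc := s.pc + 1, reg := Function.update s.reg d ((s.reg a + s.reg b) % 2 ^ w) }
  | some (.sub d a b) =>
      some { s with
        pc := s.pc + 1, reg := Function.update s.reg d ((s.reg a + 2 ^ w - s.reg b) % 2 ^ w) }
  | some (.load d a) =>
      some { s with pc := s.pc + 1, reg := Function.update s.reg d (s.mem (s.reg a)) }
  | some (.store a b) =>
      some { s with pc := s.pc + 1, mem := Function.update s.mem (s.reg a) (s.reg b) }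
  | some (.jump l) => some { s with pc := l }
  | some (.jumpEq a b l) => some { s with pc := if s.reg a = s.reg b then l else s.pc + 1 }
  | some (.jumpLt a b l) => some { s with pc := if s.reg a < s.reg b then l else s.pc + 1 }
  | some (.write a) => some { s with pc := s.pc + 1, output := s.output ++ [s.reg a] }

/-- `Steps w P t s s'`: exactly `t` steps lead from `s` to `s'`. -/
inductive Steps (w : ℕ) (P : List Instr) : ℕ → Config → Config → Prop where
  | refl (s : Config) : Steps w P 0 s s
  | head {t : ℕ} {s s' s'' : Config} :
      step w P s = some s' → Steps w P t s' s'' → Steps w P (t + 1) s s''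

/-- The initial configuration on input `T`: the characters of `T` are in the cells
`0, …, T.length - 1`, the length of `T` is in register `0`, everything else is `0`. -/
def init (T : List ℕ) : Config where
  pc := 0
  reg := fun r => if r = 0 then T.length else 0
  mem := fun i => T.getD i 0
  output := []

/-- With `w`-bit words, `P` on input `T` stops after exactly `t` steps with output `o`. -/
def Computes (w : ℕ) (P : List Instr) (T : List ℕ) (t : ℕ) (o : List ℕ) : Prop :=
  ∃ s : Config, Steps w P t (init T) s ∧ step w P s = none ∧ s.output = o

end WordRAM

/-! Uniqueness is an exchange argument. A border longer than half of `T` overlaps itself in a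
shorter border, so the shortest border `x` occurs at both ends of `T` without overlap. Peeling
shortest borders therefore always yields a block palindrome, ending at an unbordered center. If
another block palindrome of `T` has an outermost block `b ≠ x`, then `x` is also the shortest border
of `b`, so `b = x ++ y ++ x`, and cutting `b` up at both ends gives strictly more blocks. By
induction on the number of peeled blocks, the greedy factorization beats every other one strictly
(`BlockPalindrome.greedy_max`).

For linear time, let `S = T₀ T_{N-1} T₁ T_{N-2} ⋯` (`zipped`). Once `q` characters are peeled from
each end, a border of length `l` of the rest, at most half as long as the rest, is the same as an
even palindrome of `S` on the positions from `2q` to `2q + 2l - 1` (`isBorder_take_iff_evenPal`).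
Greedy peeling of `T` thus splits shortest even palindromes off the front of `S`. Manacher's
algorithm finds the maximal radii of all centers from left to right (`IsRadius.of_mirror`). The
first center `i > 2q` whose palindrome reaches back to `2q` gives the next block length `i - 2q`.
`ScanInv` carries this through the RAM program, and a potential function bounds the number of
rounds. -/

/-! ### Borders and shortest borders -/

theorem IsBorder.length_lt {α : Type*} {x T : List α} (h : IsBorder x T) :
    x.length < T.length := by
  refine lt_of_le_of_ne h.2.2.1.length_le fun he => h.2.1 (h.2.2.1.eq_of_length he)

theorem IsBorder.length_pos {α : Type*} {x T : List α} (h : IsBorder x T) : 0 < x.length :=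
  List.length_pos_iff.2 h.1

theorem IsBorder.trans {α : Type*} {x y T : List α} (h : IsBorder x y) (h' : IsBorder y T) :
    IsBorder x T := by
  refine ⟨h.1, fun he => ?_, h.2.2.1.trans h'.2.2.1, h.2.2.2.trans h'.2.2.2⟩
  have := h.length_lt
  have := h'.length_lt
  subst he
  omega

theorem IsBorder.of_length_lt {α : Type*} {x y T : List α} (h : IsBorder x T)
    (h' : IsBorder y T) (hl : x.length < y.length) : IsBorder x y := by
  refine ⟨h.1, fun he => by simp [he] at hl, ?_, ?_⟩
  · exact List.prefix_of_prefix_length_le h.2.2.1 h'.2.2.1 hl.le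
  · exact List.suffix_of_suffix_length_le h.2.2.2 h'.2.2.2 hl.le

theorem IsBorder.eq_of_length {α : Type*} {x y T : List α} (h : IsBorder x T)
    (h' : IsBorder y T) (hl : x.length = y.length) : x = y :=
  (List.prefix_of_prefix_length_le h.2.2.1 h'.2.2.1 hl.le).eq_of_length hl

/-- A border longer than half of the string overlaps itself in a shorter border. -/
theorem IsBorder.exists_shorter {α : Type*} {x T : List α} (h : IsBorder x T)
    (hl : T.length < 2 * x.length) : ∃ y, IsBorder y T ∧ y.length < x.length := by
  have hlt := h.length_lt
  have hp := List.prefix_iff_eq_take.1 h.2.2.1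
  have hs := List.suffix_iff_eq_drop.1 h.2.2.2
  -- The prefix and the suffix occurrence of `x` in `T` overlap in `2|x| - |T|` characters; this
  -- overlap is a suffix of the former and a prefix of the latter.
  have key : x.drop (T.length - x.length) = x.take (2 * x.length - T.length) := by
    conv_lhs => rw [hp]
    conv_rhs => rw [hs]
    rw [List.drop_take]
    simp only [List.length_drop]
    rw [List.length_take]
    congr 1
    · omega
    · congr 1
      omega
  refine ⟨x.drop (T.length - x.length), IsBorder.trans (y := x) ⟨?_, ?_, ?_, ?_⟩ h, ?_⟩
  · apply List.ne_nil_of_length_pos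
    simp only [List.length_drop]; omega
  · intro he
    have := congrArg List.length he
    simp only [List.length_drop] at this; omega
  · rw [key]; exact List.take_prefix _ _
  · exact List.drop_suffix _ _
  · simp only [List.length_drop]; omega

theorem IsShortestBorder.two_mul_length_le {α : Type*} {x T : List α}
    (h : IsShortestBorder x T) : 2 * x.length ≤ T.length := by
  by_contra hl
  obtain ⟨y, hy, hlt⟩ := h.1.exists_shorter (by omega)
  have := h.2 y hy
  omega

theorem IsBorder.exists_eq_append {α : Type*} {x T : List α}
    (h : IsBorder x T) (hl : 2 * x.length ≤ T.length) : ∃ y, T = x ++ y ++ x := by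
  obtain ⟨z, hz⟩ := h.2.2.1
  have h2 : x <:+ z := by
    refine List.suffix_of_suffix_length_le h.2.2.2 ⟨x, hz⟩ ?_
    have := congrArg List.length hz
    simp only [List.length_append] at this
    omega
  obtain ⟨y, hy⟩ := h2
  exact ⟨y, by rw [← hz, ← hy, List.append_assoc]⟩

theorem isBorder_append {α : Type*} {x y : List α} (hx : x ≠ []) :
    IsBorder x (x ++ y ++ x) := by
  refine ⟨hx, fun h => ?_, ⟨y ++ x, by simp⟩, ⟨x ++ y, rfl⟩⟩
  have := congrArg List.length h
  have := List.length_pos_iff.2 hx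
  simp only [List.length_append] at *
  omega

theorem exists_isShortestBorder {α : Type*} {x T : List α} (h : IsBorder x T) :
    ∃ y, IsShortestBorder y T := by
  classical
  have hex : ∃ n, ∃ y, IsBorder y T ∧ y.length = n := ⟨_, x, h, rfl⟩
  obtain ⟨y, hy, hl⟩ := Nat.find_spec hex
  exact ⟨y, hy, fun z hz => hl ▸ Nat.find_min' hex ⟨z, hz, rfl⟩⟩

/-! ### The greedy factorization is the unique largest one -/

namespace BlockPalindrome

variable {α : Type*}

theorem ext_of_eq {f g : BlockPalindrome α} (hc : f.center = g.center) (ha : f.arms = g.arms) :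
    f = g := by
  cases f; cases g; simp_all

theorem word_eq (f : BlockPalindrome α) :
    f.word = f.arms.reverse.flatten ++ f.center ++ f.arms.flatten := by
  simp [word, blocks]

theorem size_eq [DecidableEq α] (f : BlockPalindrome α) :
    f.size = 2 * f.arms.length + if f.center = [] then 0 else 1 := by
  have h : f.arms.countP (fun b => !b.isEmpty) = f.arms.length := by
    rw [List.countP_eq_length]
    intro b hb
    simpa using f.arms_ne_nil b hb
  simp only [size, blocks, List.countP_append, List.countP_reverse, List.countP_cons, h]
  by_cases hc : f.center = [] <;> simp [hc] <;> omega

theorem core_eq (f : BlockPalindrome α) (i : ℕ) :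
    f.core i = (f.arms.take i).reverse.flatten ++ f.center ++ (f.arms.take i).flatten := by
  simp [core]

theorem length_sum_arms (f : BlockPalindrome α) :
    f.arms.reverse.flatten.length = f.arms.flatten.length := by
  simp [List.length_flatten]

/-- Induction on the arms of `f`, removing the outermost block `x`. The size bound and the equality
case are proved together, because stripping equal outer blocks needs both. -/
theorem greedy_max {f : BlockPalindrome α} (hf : f.IsGreedy) (g : BlockPalindrome α)
    (hw : g.word = f.word) : g.size ≤ f.size ∧ (g.size = f.size → g = f) := by
  classical
  obtain ⟨c, arms, hne⟩ := f
  induction arms using List.reverseRecOn generalizing g with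
  | nil =>
    have hg : g.arms = [] := by
      by_contra h
      obtain ⟨bs, b, hb⟩ := List.eq_nil_or_concat g.arms |>.resolve_left h
      have h1 : g.word = b ++ (bs.reverse.flatten ++ g.center ++ bs.flatten) ++ b := by
        simp [word_eq, hb]
      have h2 := isBorder_append (y := bs.reverse.flatten ++ g.center ++ bs.flatten)
        (g.arms_ne_nil b (by simp [hb]))
      rw [← h1, hw] at h2
      simp only [word_eq, List.reverse_nil, List.flatten_nil, List.nil_append,
        List.append_nil] at h2
      exact hf.1 _ h2
    have he : g = ⟨c, [], hne⟩ := by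
      refine ext_of_eq ?_ hg
      simpa [word_eq, hg] using hw
    subst he
    simp
  | append_singleton as x ih =>
    have hx : x ≠ [] := hne x (by simp)
    have hne' : ∀ b ∈ as, b ≠ [] := fun b hb => hne b (by simp [hb])
    set f : BlockPalindrome α := ⟨c, as ++ [x], hne⟩ with hfdef
    set f' : BlockPalindrome α := ⟨c, as, hne'⟩ with hf'def
    have hfw : f.word = x ++ f'.word ++ x := by simp [word_eq, f, f']
    have hf' : f'.IsGreedy := by
      refine ⟨hf.1, fun i hi => ?_⟩
      change i < as.length at hi
      have h := hf.2 i (by simp [f]; omega)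
      have e1 : f.arms[i]'(by simp [f]; omega) = f'.arms[i] := by
        simp [f, f', List.getElem_append_left, hi]
      have e2 : f.core (i + 1) = f'.core (i + 1) := by
        simp only [core_eq, f, f']
        rw [List.take_append_of_le_length (by omega)]
      rwa [e1, e2] at h
    have hxs : IsShortestBorder x f.word := by
      have h := hf.2 as.length (by simp [f])
      have e2 : f.core (as.length + 1) = f.word := by
        simp only [core_eq, word_eq, f]
        rw [List.take_of_length_le (by simp)]
      rw [e2] at h
      simpa [f] using h
    have hsz : f.size = f'.size + 2 := by
      simp only [size_eq, f, f', List.length_append, List.length_singleton]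
      omega
    rcases List.eq_nil_or_concat g.arms with hg | ⟨bs, b, hb⟩
    · have h1 : g.size ≤ 1 := by
        rw [size_eq, hg]; split_ifs <;> simp
      exact ⟨by omega, fun h => by omega⟩
    · have hbs : ∀ d ∈ bs, d ≠ [] := fun d hd => g.arms_ne_nil d (by simp [hb, hd])
      have hb0 : b ≠ [] := g.arms_ne_nil b (by simp [hb])
      set g' : BlockPalindrome α := ⟨g.center, bs, hbs⟩ with hg'def
      have hgw : g.word = b ++ g'.word ++ b := by simp [word_eq, hb, g']
      have hgs : g.size = g'.size + 2 := by
        simp only [size_eq, hb, g', List.length_concat]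
        omega
      have hbb : IsBorder b f.word := by
        rw [← hw, hgw]; exact isBorder_append hb0
      rcases (hxs.2 b hbb).eq_or_lt with hl | hl
      · have hxb : x = b := hxs.1.eq_of_length hbb hl
        subst hxb
        have hw' : g'.word = f'.word := by
          have h : x ++ g'.word ++ x = x ++ f'.word ++ x := by rw [← hgw, ← hfw, hw]
          simpa using h
        obtain ⟨h1, h2⟩ : g'.size ≤ f'.size ∧ (g'.size = f'.size → g' = f') :=
          ih g' hne' hf' hw'
        refine ⟨by omega, fun h => ?_⟩
        have h3 := h2 (by omega)
        have hc : g.center = c := congrArg center h3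
        have ha : bs = as := congrArg arms h3
        exact ext_of_eq hc (by simp [hb, ha, f])
      -- Here `b = x ++ y ++ x`. Stripping one `x` from each end of the word leaves `y ++ x ++
      -- g'.word ++ x ++ y`, a block palindrome `e` of `f'.word` with at least as many blocks as
      -- `g`. Hence `g.size ≤ f'.size < f.size`, and equality is impossible.
      · have hxb := hxs.1.of_length_lt hbb hl
        have hxs' : IsShortestBorder x b := ⟨hxb, fun y hy => hxs.2 y (hy.trans hbb)⟩
        obtain ⟨y, hy⟩ := hxb.exists_eq_append hxs'.two_mul_length_le
        have hext : ∀ d ∈ bs ++ (if y = [] then [x] else [x, y]), d ≠ [] := by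
          intro d hd
          rcases List.mem_append.1 hd with hd | hd
          · exact hbs d hd
          · split_ifs at hd with hy0
            · simp only [List.mem_singleton] at hd; exact hd ▸ hx
            · simp only [List.mem_cons, List.not_mem_nil, or_false] at hd
              rcases hd with rfl | rfl <;> assumption
        set e : BlockPalindrome α := ⟨g.center, bs ++ (if y = [] then [x] else [x, y]), hext⟩
        have hew : e.word = y ++ x ++ g'.word ++ x ++ y := by
          by_cases hy0 : y = []
          · simp [word_eq, e, g', hy0]
          · simp [word_eq, e, g', hy0]
        have hw' : e.word = f'.word := by
          have h : x ++ e.word ++ x = x ++ f'.word ++ x := by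
            rw [hew, ← hfw, ← hw, hgw, hy]; simp
          simpa using h
        have hes : g'.size + 2 ≤ e.size := by
          simp only [size_eq, e, g', List.length_append]
          split_ifs <;> simp <;> omega
        have : e.size ≤ f'.size := (ih e hne' hf' hw').1
        exact ⟨by omega, fun h => by omega⟩

/-- The outer blocks are shortest borders; nothing is said about the center. -/
def OuterGreedy (f : BlockPalindrome α) : Prop :=
  ∀ (i : ℕ) (h : i < f.arms.length), IsShortestBorder f.arms[i] (f.core (i + 1))

/-- Split the center `x ++ y ++ x` into three blocks. -/
def splitCenter (f : BlockPalindrome α) (x y : List α) (hx : x ≠ []) : BlockPalindrome α where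
  center := y
  arms := x :: f.arms
  arms_ne_nil := by
    intro b hb
    rcases List.mem_cons.1 hb with rfl | hb
    · exact hx
    · exact f.arms_ne_nil b hb

theorem word_splitCenter {f : BlockPalindrome α} {x y : List α} (hx : x ≠ [])
    (hc : f.center = x ++ y ++ x) : (f.splitCenter x y hx).word = f.word := by
  simp [word_eq, splitCenter, hc]

/-- The new arm is innermost, so the old cores persist with their index shifted by one; the only new
condition concerns the old center itself. -/
theorem OuterGreedy.splitCenter {f : BlockPalindrome α} (hf : f.OuterGreedy) {x y : List α}
    (hx : x ≠ []) (hc : f.center = x ++ y ++ x) (hs : IsShortestBorder x f.center) :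
    (f.splitCenter x y hx).OuterGreedy := by
  intro i hi
  have hcore : (f.splitCenter x y hx).core (i + 1) = f.core i := by
    simp [core_eq, BlockPalindrome.splitCenter, hc]
  rw [hcore]
  cases i with
  | zero => simpa [core_eq, BlockPalindrome.splitCenter] using hs
  | succ i => exact hf i (by simpa [BlockPalindrome.splitCenter] using hi)

theorem OuterGreedy.exists_isGreedy {f : BlockPalindrome α} (hf : f.OuterGreedy) :
    ∃ g : BlockPalindrome α, g.word = f.word ∧ g.IsGreedy := by
  induction hn : f.center.length using Nat.strong_induction_on generalizing f with
  | _ n ih =>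
    by_cases h : Unbordered f.center
    · exact ⟨f, rfl, h, hf⟩
    · simp only [Unbordered, not_forall, not_not] at h
      obtain ⟨z, hz⟩ := h
      obtain ⟨x, hx⟩ := exists_isShortestBorder hz
      obtain ⟨y, hy⟩ := hx.1.exists_eq_append hx.two_mul_length_le
      have hlt : y.length < n := by
        have := hx.1.length_pos
        rw [← hn, hy]; simp only [List.length_append]; omega
      obtain ⟨g, hg, hg'⟩ := ih _ hlt (hf.splitCenter hx.1.1 hy hx) rfl
      exact ⟨g, hg.trans (word_splitCenter hx.1.1 hy), hg'⟩

/-- The factorization into a single block. -/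
def single (T : List α) : BlockPalindrome α where
  center := T
  arms := []
  arms_ne_nil := by simp

theorem single_outerGreedy (T : List α) : (single T).OuterGreedy := by
  intro i hi
  simp [single] at hi

theorem exists_isGreedy (T : List α) : ∃ f : BlockPalindrome α, f.word = T ∧ f.IsGreedy := by
  obtain ⟨g, hg, hg'⟩ := (single_outerGreedy T).exists_isGreedy
  exact ⟨g, by simpa [word_eq, single] using hg, hg'⟩

theorem IsGreedy.isLargest {f : BlockPalindrome α} (hf : f.IsGreedy) : f.IsLargest f.word :=
  ⟨rfl, fun g hg => (greedy_max hf g hg).1⟩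

theorem IsLargest.eq_of_isGreedy {f g : BlockPalindrome α} {T : List α} (hf : f.IsLargest T)
    (hg : g.IsGreedy) (hgT : g.word = T) : f = g := by
  have hfg : f.word = g.word := hf.1.trans hgT.symm
  exact (greedy_max hg f hfg).2
    (le_antisymm (greedy_max hg f hfg).1 (hf.2 g hgT))

theorem existsUnique_isLargest (T : List α) : ∃! f : BlockPalindrome α, f.IsLargest T := by
  obtain ⟨g, rfl, hg⟩ := exists_isGreedy T
  exact ⟨g, hg.isLargest, fun f hf => hf.eq_of_isGreedy hg rfl⟩

theorem isLargest_iff_isGreedy {f : BlockPalindrome α} {T : List α} (hf : f.word = T) :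
    f.IsLargest T ↔ f.IsGreedy := by
  subst hf
  refine ⟨fun h => ?_, fun h => h.isLargest⟩
  obtain ⟨g, hgw, hg⟩ := exists_isGreedy f.word
  exact (h.eq_of_isGreedy hg hgw) ▸ hg

end BlockPalindrome

/-! ### Even palindromes and Manacher's rule -/

/-- The radius-`k` neighbourhood of the cut before position `c` in `S` is an even palindrome. -/
def EvenPal (S : ℕ → ℕ) (c k : ℕ) : Prop :=
  ∀ d < k, S (c + d) = S (c - 1 - d)

/-- `k` is the radius of the longest even palindrome of `S 0, …, S (N - 1)` with center `c`. -/
structure IsRadius (S : ℕ → ℕ) (N c k : ℕ) : Prop where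
  le : k ≤ c
  add_le : c + k ≤ N
  pal : EvenPal S c k
  maximal : k < c → c + k < N → S (c + k) ≠ S (c - 1 - k)

theorem IsRadius.le_of_evenPal {S : ℕ → ℕ} {N c k j : ℕ} (h : IsRadius S N c k)
    (hj : EvenPal S c j) (h1 : j ≤ c) (h2 : c + j ≤ N) : j ≤ k := by
  by_contra hlt
  exact h.maximal (by omega) (by omega) (hj k (by omega))

theorem EvenPal.mono {S : ℕ → ℕ} {c k j : ℕ} (h : EvenPal S c k) (hj : j ≤ k) : EvenPal S c j :=
  fun d hd => h d (by omega)

theorem EvenPal.succ {S : ℕ → ℕ} {c k : ℕ} (h : EvenPal S c k) (hk : S (c + k) = S (c - 1 - k)) :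
    EvenPal S c (k + 1) := by
  intro d hd
  rcases Nat.lt_succ_iff_lt_or_eq.1 hd with hd | rfl
  · exact h d hd
  · exact hk

theorem EvenPal.mirror {S : ℕ → ℕ} {c r : ℕ} (h : EvenPal S c r) (hr : r ≤ c) {j j' : ℕ}
    (h1 : c - r ≤ j) (h2 : j < c + r) (hj : j + j' + 1 = 2 * c) : S j = S j' := by
  rcases lt_or_ge j c with hlt | hge
  · have := h (c - 1 - j) (by omega)
    rw [show c + (c - 1 - j) = j' by omega, show c - 1 - (c - 1 - j) = j by omega] at this
    exact this.symm
  · have := h (j - c) (by omega)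
    rwa [show c + (j - c) = j by omega, show c - 1 - (j - c) = j' by omega] at this

/-- Reflection in `c` maps the window around `2 * c - i` onto the one around `i`. It exchanges the
two halves, which does not affect being a palindrome. -/
theorem EvenPal.of_mirror {S : ℕ → ℕ} {c r i k : ℕ} (h : EvenPal S c r) (hr : r ≤ c)
    (hci : c ≤ i) (hk : EvenPal S (2 * c - i) k) (hik : i + k ≤ c + r) (hkm : k ≤ 2 * c - i) :
    EvenPal S i k := by
  intro d hd
  have h0 := hk d hd
  rw [h.mirror hr (j := i + d) (j' := 2 * c - i - 1 - d) (by omega) (by omega) (by omega),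
    h.mirror hr (j := i - 1 - d) (j' := 2 * c - i + d) (by omega) (by omega) (by omega), h0]

/-- Manacher's copying rule. -/
theorem IsRadius.of_mirror {S : ℕ → ℕ} {N c r i k : ℕ} (h : EvenPal S c r) (hr : r ≤ c)
    (hN : c + r ≤ N) (hci : c ≤ i) (hk : IsRadius S N (2 * c - i) k) (hik : i + k < c + r) :
    IsRadius S N i k := by
  have hkm := hk.le
  -- Since `hik` is strict, the two characters just outside the palindrome still lie in the window
  -- of `c`, so the mismatch is reflected as well.
  refine ⟨by omega, by omega, h.of_mirror hr hci hk.pal hik.le hkm, fun h1 h2 he => ?_⟩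
  refine hk.maximal (by omega) (by omega) ?_
  rw [h.mirror hr (j := i + k) (j' := 2 * c - i - 1 - k) (by omega) (by omega) (by omega),
    h.mirror hr (j := i - 1 - k) (j' := 2 * c - i + k) (by omega) (by omega) (by omega)] at he
  exact he.symm

/-! ### Borders of the middle part as palindromes of the zipped string -/

/-- The string `T` read alternately from the left and from the right end. -/
def zipped (T : List ℕ) (j : ℕ) : ℕ :=
  if j % 2 = 0 then T.getD (j / 2) 0 else T.getD (T.length - 1 - j / 2) 0

theorem zipped_even (T : List ℕ) (j : ℕ) : zipped T (2 * j) = T.getD j 0 := by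
  simp [zipped]

theorem zipped_odd (T : List ℕ) (j : ℕ) : zipped T (2 * j + 1) = T.getD (T.length - 1 - j) 0 := by
  have h1 : (2 * j + 1) % 2 = 1 := by omega
  have h2 : (2 * j + 1) / 2 = j := by omega
  simp [zipped, h1, h2]

theorem isBorder_take_iff_getD {U : List ℕ} {l : ℕ} (hl : 0 < l) (hlU : 2 * l ≤ U.length) :
    IsBorder (U.take l) U ↔ ∀ e < l, U.getD e 0 = U.getD (U.length - l + e) 0 := by
  have hlen : (U.take l).length = l := by simp; omega
  constructor
  · intro h e he
    have h1 := List.suffix_iff_eq_drop.1 h.2.2.2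
    rw [hlen] at h1
    have h2 := congrArg (fun z => z.getD e 0) h1
    simpa [List.getD_eq_getElem?_getD, List.getElem?_take, he] using h2
  · intro h
    refine ⟨fun h0 => ?_, fun h0 => ?_, List.take_prefix _ _, List.suffix_iff_eq_drop.2 ?_⟩
    · rw [h0] at hlen; simp at hlen; omega
    · rw [h0] at hlen; omega
    · rw [hlen]
      refine List.ext_getElem (by simp; omega) fun e h1 h2 => ?_
      have he : e < l := by omega
      have h3 := h e he
      rw [List.getD_eq_getElem _ _ (by omega), List.getD_eq_getElem _ _ (by omega)] at h3
      simpa using h3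

/-- The character `e` of the prefix sits at zipped position `2(|A| + e)`, its partner in the suffix
at `2(|A| + l - 1 - e) + 1`. These add up to `2(2|A| + l) - 1`, so they are mirror images in the
center `2|A| + l`. -/
theorem isBorder_take_iff_evenPal {T A U B : List ℕ} (hT : T = A ++ U ++ B)
    (hAB : A.length = B.length) {l : ℕ} (hl : 0 < l) (hlU : 2 * l ≤ U.length) :
    IsBorder (U.take l) U ↔ EvenPal (zipped T) (2 * A.length + l) l := by
  have hN : T.length = 2 * A.length + U.length := by
    simp only [hT, List.length_append]; omega
  have hg : ∀ e < U.length, U.getD e 0 = T.getD (A.length + e) 0 := by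
    intro e he
    rw [hT, List.append_assoc, List.getD_append_right _ _ _ _ (by omega), Nat.add_sub_cancel_left,
      List.getD_append _ _ _ _ he]
  have key : ∀ e < l, (U.getD e 0 = U.getD (U.length - l + e) 0 ↔
      zipped T (2 * (A.length + e)) = zipped T (2 * (A.length + l - 1 - e) + 1)) := by
    intro e he
    rw [zipped_even, zipped_odd, hg _ (by omega), hg _ (by omega),
      show A.length + (U.length - l + e) = T.length - 1 - (A.length + l - 1 - e) by omega]
  rw [isBorder_take_iff_getD hl hlU]
  constructor
  · intro h d hd
    -- Mirror images have opposite parity; the even one comes from the left end of `T` and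
    -- determines `e`.
    rcases Nat.even_or_odd' (l + d) with ⟨e, he | he⟩
    · have := (key e (by omega)).1 (h e (by omega))
      rwa [show 2 * (A.length + e) = 2 * A.length + l + d by omega,
        show 2 * (A.length + l - 1 - e) + 1 = 2 * A.length + l - 1 - d by omega] at this
    · have := (key (l - 1 - e) (by omega)).1 (h _ (by omega))
      rw [show 2 * (A.length + (l - 1 - e)) = 2 * A.length + l - 1 - d by omega,
        show 2 * (A.length + l - 1 - (l - 1 - e)) + 1 = 2 * A.length + l + d by omega] at this
      exact this.symm
  · intro h e he
    exact (key e he).2 (h.mirror (by omega) (by omega) (by omega) (by omega))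

theorem IsBorder.eq_take {α : Type*} {x U : List α} (h : IsBorder x U) : x = U.take x.length :=
  List.prefix_iff_eq_take.1 h.2.2.1

/-! ### Partially peeled factorizations -/

/-- An intermediate state of greedy peeling: the blocks of lengths `L`, from the outermost one
inward, have been split off from both ends of `T`, and `q` is their total length. -/
structure Peeled (T : List ℕ) (q : ℕ) (L : List ℕ) (f : BlockPalindrome ℕ) : Prop where
  word_eq : f.word = T
  outer : f.OuterGreedy
  length_eq : f.arms.flatten.length = q
  lengths_eq : f.arms.reverse.map List.length = L

namespace Peeled

variable {T L : List ℕ} {q : ℕ} {f : BlockPalindrome ℕ}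

theorem length_word (h : Peeled T q L f) : T.length = 2 * q + f.center.length := by
  rw [← h.word_eq, f.word_eq, List.length_append, List.length_append, f.length_sum_arms,
    h.length_eq]
  omega

/-- Blocks are non-empty. This bounds the height of the stack of lengths. -/
theorem length_le (h : Peeled T q L f) : L.length ≤ q := by
  rw [← h.lengths_eq, ← h.length_eq, List.length_flatten, List.length_map, List.length_reverse,
    ← List.length_map (f := List.length)]
  refine List.length_le_sum_of_one_le _ fun i hi => ?_
  obtain ⟨b, hb, rfl⟩ := List.mem_map.1 hi
  exact List.length_pos_iff.2 (f.arms_ne_nil b hb)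

theorem isBorder_iff (h : Peeled T q L f) {l : ℕ} (hl : 0 < l) (hlU : 2 * l ≤ f.center.length) :
    IsBorder (f.center.take l) f.center ↔ EvenPal (zipped T) (2 * q + l) l := by
  rw [isBorder_take_iff_evenPal (h.word_eq.symm.trans f.word_eq) f.length_sum_arms hl hlU,
    f.length_sum_arms, h.length_eq]

theorem isGreedy (h : Peeled T q L f)
    (hn : ∀ l, 0 < l → 2 * q + 2 * l ≤ T.length → ¬ EvenPal (zipped T) (2 * q + l) l) :
    f.IsGreedy := by
  refine ⟨fun x hx => ?_, h.outer⟩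
  obtain ⟨y, hy⟩ := exists_isShortestBorder hx
  have h1 := hy.two_mul_length_le
  have h2 := h.length_word
  refine hn y.length hy.1.length_pos (by omega) ((h.isBorder_iff hy.1.length_pos h1).1 ?_)
  rw [← hy.1.eq_take]
  exact hy.1

theorem map_length_blocks (h : Peeled T q L f) :
    f.blocks.map List.length = L ++ (T.length - 2 * q) :: L.reverse := by
  have h2 := h.length_word
  rw [← h.lengths_eq, ← List.map_reverse, List.reverse_reverse, h2, Nat.add_sub_cancel_left]
  simp [BlockPalindrome.blocks]

theorem split (h : Peeled T q L f) {l : ℕ} (hl : 0 < l) (hlT : 2 * q + 2 * l ≤ T.length)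
    (hp : EvenPal (zipped T) (2 * q + l) l)
    (hn : ∀ k, 0 < k → k < l → ¬ EvenPal (zipped T) (2 * q + k) k) :
    ∃ f', Peeled T (q + l) (L ++ [l]) f' := by
  have h2 := h.length_word
  have hlU : 2 * l ≤ f.center.length := by omega
  have hlen : (f.center.take l).length = l := by simp; omega
  have hb := (h.isBorder_iff hl hlU).2 hp
  have hs : IsShortestBorder (f.center.take l) f.center := by
    refine ⟨hb, fun y hy => ?_⟩
    -- The border `y` may exceed half of the center, where the palindrome criterion does not apply;
    -- the shortest border does not.
    obtain ⟨z, hz⟩ := exists_isShortestBorder hy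
    refine le_trans ?_ (hz.2 y hy)
    rw [hlen]
    by_contra hlt
    refine hn z.length hz.1.length_pos (by omega)
      ((h.isBorder_iff hz.1.length_pos hz.two_mul_length_le).1 ?_)
    rw [← hz.1.eq_take]
    exact hz.1
  obtain ⟨y, hy⟩ := hb.exists_eq_append (by omega)
  refine ⟨f.splitCenter _ y hb.1, (BlockPalindrome.word_splitCenter hb.1 hy).trans h.word_eq,
    h.outer.splitCenter hb.1 hy hs, ?_, ?_⟩
  · simp only [BlockPalindrome.splitCenter, List.flatten_cons, List.length_append, hlen,
      h.length_eq]
    omega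
  · simp only [BlockPalindrome.splitCenter, List.reverse_cons, List.map_append, h.lengths_eq,
      List.map_cons, List.map_nil, hlen]

end Peeled

theorem peeled_single (T : List ℕ) : Peeled T 0 [] (BlockPalindrome.single T) :=
  ⟨by simp [BlockPalindrome.word_eq, BlockPalindrome.single],
    BlockPalindrome.single_outerGreedy T, rfl, rfl⟩

/-! ### Symbolic execution of RAM programs -/

namespace WordRAM

theorem Steps.trans {w : ℕ} {P : List Instr} {t u : ℕ} {s s' s'' : Config}
    (h : Steps w P t s s') (h' : Steps w P u s' s'') : Steps w P (t + u) s s'' := by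
  induction h with
  | refl => simpa using h'
  | head hs _ ih => rw [Nat.add_right_comm]; exact .head hs (ih h')

/-- A loop whose every round takes at most `K` steps and decreases a counter. -/
theorem exists_steps_of_loop {w : ℕ} {P : List Instr} {K : ℕ} {Inv : ℕ → Config → Prop}
    {Post : Config → Prop}
    (h : ∀ m s, Inv m s → Post s ∨
      ∃ t s' m', t ≤ K ∧ Steps w P t s s' ∧ Inv m' s' ∧ m' < m)
    {m : ℕ} {s : Config} (hs : Inv m s) :
    ∃ t s', t ≤ K * m ∧ Steps w P t s s' ∧ Post s' := by
  induction m using Nat.strong_induction_on generalizing s with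
  | _ m ih =>
    rcases h m s hs with hp | ⟨t, s', m', ht, hst, hs', hm⟩
    · exact ⟨0, s, Nat.zero_le _, .refl s, hp⟩
    · obtain ⟨u, s'', hu, hsu, hp⟩ := ih m' hm hs'
      refine ⟨t + u, s'', ?_, hst.trans hsu, hp⟩
      calc t + u ≤ K * (m' + 1) := by rw [Nat.mul_succ]; omega
        _ ≤ K * m := Nat.mul_le_mul_left K hm

/-- The registers with the contents `l`, followed by zeros. -/
def regs (l : List ℕ) (r : ℕ) : ℕ := l.getD r 0

theorem update_regs {l : List ℕ} {d v : ℕ} (hd : d < l.length) :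
    Function.update (regs l) d v = regs (l.set d v) := by
  funext r
  by_cases hr : r = d
  · subst hr
    simp [regs, hd]
  · simp [regs, Function.update_of_ne hr, List.getD_eq_getElem?_getD,
      List.getElem?_set_ne (Ne.symm hr)]

theorem regs_cons_zero (x : ℕ) (l : List ℕ) : regs (x :: l) 0 = x := rfl

theorem regs_cons_succ (x : ℕ) (l : List ℕ) (n : ℕ) : regs (x :: l) (n + 1) = regs l n := rfl

section Instructions

variable {w : ℕ} {P : List Instr} {t pc d a b k j : ℕ} {l : List ℕ} {mem : ℕ → ℕ}
  {out : List ℕ} {s : Config}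

/-- The instruction rules take the rest of the run as a premise, so that a whole path is traced by
applying them in order. The bounds in the arithmetic rules exclude wraparound. -/
theorem steps_const (hP : P[pc]? = some (.const d k)) (hd : d < l.length) (hk : k < 2 ^ w)
    (h : Steps w P t ⟨pc + 1, regs (l.set d k), mem, out⟩ s) :
    Steps w P (t + 1) ⟨pc, regs l, mem, out⟩ s :=
  .head (by simp only [step, hP, update_regs hd, Nat.mod_eq_of_lt hk]) h

theorem steps_copy (hP : P[pc]? = some (.copy d a)) (hd : d < l.length)
    (h : Steps w P t ⟨pc + 1, regs (l.set d (regs l a)), mem, out⟩ s) :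
    Steps w P (t + 1) ⟨pc, regs l, mem, out⟩ s :=
  .head (by simp only [step, hP, update_regs hd]) h

theorem steps_add (hP : P[pc]? = some (.add d a b)) (hd : d < l.length)
    (hk : regs l a + regs l b < 2 ^ w)
    (h : Steps w P t ⟨pc + 1, regs (l.set d (regs l a + regs l b)), mem, out⟩ s) :
    Steps w P (t + 1) ⟨pc, regs l, mem, out⟩ s :=
  .head (by simp only [step, hP, update_regs hd, Nat.mod_eq_of_lt hk]) h

theorem steps_sub (hP : P[pc]? = some (.sub d a b)) (hd : d < l.length)
    (hk : regs l b ≤ regs l a ∧ regs l a < 2 ^ w)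
    (h : Steps w P t ⟨pc + 1, regs (l.set d (regs l a - regs l b)), mem, out⟩ s) :
    Steps w P (t + 1) ⟨pc, regs l, mem, out⟩ s := by
  refine .head ?_ h
  simp only [step, hP, update_regs hd]
  rw [Nat.sub_add_comm hk.1, Nat.add_mod_right, Nat.mod_eq_of_lt (by omega)]

theorem steps_load (hP : P[pc]? = some (.load d a)) (hd : d < l.length)
    (h : Steps w P t ⟨pc + 1, regs (l.set d (mem (regs l a))), mem, out⟩ s) :
    Steps w P (t + 1) ⟨pc, regs l, mem, out⟩ s :=
  .head (by simp only [step, hP, update_regs hd]) h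

theorem steps_store (hP : P[pc]? = some (.store a b))
    (h : Steps w P t ⟨pc + 1, regs l, Function.update mem (regs l a) (regs l b), out⟩ s) :
    Steps w P (t + 1) ⟨pc, regs l, mem, out⟩ s :=
  .head (by simp only [step, hP]) h

theorem steps_write (hP : P[pc]? = some (.write a))
    (h : Steps w P t ⟨pc + 1, regs l, mem, out ++ [regs l a]⟩ s) :
    Steps w P (t + 1) ⟨pc, regs l, mem, out⟩ s :=
  .head (by simp only [step, hP]) h

theorem steps_jump (hP : P[pc]? = some (.jump j))
    (h : Steps w P t ⟨j, regs l, mem, out⟩ s) :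
    Steps w P (t + 1) ⟨pc, regs l, mem, out⟩ s :=
  .head (by simp only [step, hP]) h

theorem steps_jumpEq_pos (hP : P[pc]? = some (.jumpEq a b j)) (hk : regs l a = regs l b)
    (h : Steps w P t ⟨j, regs l, mem, out⟩ s) :
    Steps w P (t + 1) ⟨pc, regs l, mem, out⟩ s :=
  .head (by simp only [step, hP, hk, if_true]) h

theorem steps_jumpEq_neg (hP : P[pc]? = some (.jumpEq a b j)) (hk : ¬ regs l a = regs l b)
    (h : Steps w P t ⟨pc + 1, regs l, mem, out⟩ s) :
    Steps w P (t + 1) ⟨pc, regs l, mem, out⟩ s :=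
  .head (by simp only [step, hP, hk, if_false]) h

theorem steps_jumpLt_pos (hP : P[pc]? = some (.jumpLt a b j)) (hk : regs l a < regs l b)
    (h : Steps w P t ⟨j, regs l, mem, out⟩ s) :
    Steps w P (t + 1) ⟨pc, regs l, mem, out⟩ s :=
  .head (by simp only [step, hP, hk, if_true]) h

theorem steps_jumpLt_neg (hP : P[pc]? = some (.jumpLt a b j)) (hk : ¬ regs l a < regs l b)
    (h : Steps w P t ⟨pc + 1, regs l, mem, out⟩ s) :
    Steps w P (t + 1) ⟨pc, regs l, mem, out⟩ s :=
  .head (by simp only [step, hP, hk, if_false]) h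

end Instructions

/-! ### The program and its straight-line paths -/

/-- The program: it zips the input, runs Manacher's algorithm on the result, splits off a block
whenever a palindrome starts at the current offset, and finally unwinds the stack of lengths. -/
def prog : List Instr := [
  .const 8 1,
  .copy 2 0,
  .copy 3 0,
  -- Zipping: registers 1 and 2 are the left and right cursors, register 3 is the target address.
  .jumpLt 1 2 5,
  .jump 16,
  .load 6 1,
  .store 3 6,
  .add 1 1 8,
  .add 3 3 8,
  .jumpLt 1 2 11,
  .jump 16,
  .sub 2 2 8,
  .load 6 2,
  .store 3 6,
  .add 3 3 8,
  .jump 3,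
  .const 1 1,
  .const 2 1,
  .const 3 1,
  .add 9 0 0,
  .add 10 9 0,
  .copy 5 10,
  -- Head of the scan: registers 1 to 5 hold `i`, `c`, `r`, the offset `p = 2q` and the stack
  -- pointer. `c = i` means that the palindrome at `i` is being extended.
  .jumpLt 1 0 24,
  .jump 65,
  .jumpEq 2 1 36,
  .jumpLt 1 3 28,
  .copy 3 1,
  .jump 34,
  .add 6 2 2,
  .sub 6 6 1,
  .add 6 6 9,
  .load 6 6,
  .sub 7 3 1,
  .jumpLt 6 7 52,
  .copy 2 1,
  .jump 22,
  -- Extension: compare position `r` with its mirror image `2i - r - 1`.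
  .jumpLt 3 0 38,
  .jump 51,
  .add 6 1 1,
  .jumpLt 3 6 41,
  .jump 51,
  .sub 6 6 3,
  .sub 6 6 8,
  .add 6 6 0,
  .load 6 6,
  .add 7 3 0,
  .load 7 7,
  .jumpEq 6 7 49,
  .jump 51,
  .add 3 3 8,
  .jump 22,
  .sub 6 3 1,
  -- The radius of `i`, in register 6, is now final: store it and test whether the palindrome
  -- reaches back to `p`.
  .add 7 9 1,
  .store 7 6,
  .jumpLt 4 1 56,
  .jump 63,
  .add 7 4 6,
  .jumpLt 7 1 63,
  .sub 7 1 4,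
  .write 7,
  .store 5 7,
  .add 5 5 8,
  .add 4 1 7,
  .add 1 1 8,
  .jump 22,
  .sub 6 0 4,
  .write 6,
  -- Unwinding: the stack is empty when its pointer is back at `3N`.
  .jumpLt 10 5 69,
  .halt,
  .sub 5 5 8,
  .load 6 5,
  .write 6,
  .jump 67]

/-- A configuration of `prog` in its main part. -/
def cfg (pc N i c r p sp x y : ℕ) (mem : ℕ → ℕ) (out : List ℕ) : Config :=
  -- Memory consists of the input from `0`, the zipped string from `N`, the radii from `2N` and the
  -- stack from `3N`.
  ⟨pc, regs [N, i, c, r, p, sp, x, y, 1, 2 * N, 3 * N], mem, out⟩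

/-- This and the following lemmas each trace one path, the hypotheses deciding its branches. Sums
are written in the order in which the program forms them. -/
theorem steps_expand {w N i r p sp x y : ℕ} {mem : ℕ → ℕ} {out : List ℕ}
    (hN : 8 * (N + 1) ≤ 2 ^ w) (hi : i < N) (hir : i ≤ r) (hr : r < N) (hri : r < 2 * i)
    (he : mem (i + i - r - 1 + N) = mem (r + N)) :
    Steps w prog 14 (cfg 22 N i i r p sp x y mem out)
      (cfg 22 N i i (r + 1) p sp (mem (i + i - r - 1 + N)) (mem (r + N)) mem out) := by
  repeat'
    first
    | exact Steps.refl _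
    | refine steps_jump rfl ?_
    | refine steps_load rfl (by simp) ?_
    | refine steps_add rfl (by simp) (by simp only [regs_cons_zero, regs_cons_succ]; omega) ?_
    | refine steps_sub rfl (by simp) (by simp only [regs_cons_zero, regs_cons_succ]; omega) ?_
    | refine steps_jumpLt_pos rfl (by simp only [regs_cons_zero, regs_cons_succ]; omega) ?_
    | refine steps_jumpEq_pos rfl rfl ?_
    | refine steps_jumpEq_pos rfl (by simp only [regs_cons_zero, regs_cons_succ]; omega) ?_
    try simp only [regs_cons_zero, regs_cons_succ, List.set_cons_zero, List.set_cons_succ]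

theorem steps_stop_right {w N i r p sp x y : ℕ} {mem : ℕ → ℕ} {out : List ℕ}
    (hN : 8 * (N + 1) ≤ 2 ^ w) (hi : i < N) (hir : i ≤ r) (hr : ¬ r < N)
    (hr' : r ≤ 2 * i) :
    Steps w prog 5 (cfg 22 N i i r p sp x y mem out)
      (cfg 52 N i i r p sp (r - i) y mem out) := by
  repeat'
    first
    | exact Steps.refl _
    | refine steps_jump rfl ?_
    | refine steps_sub rfl (by simp) (by simp only [regs_cons_zero, regs_cons_succ]; omega) ?_
    | refine steps_jumpLt_pos rfl (by simp only [regs_cons_zero, regs_cons_succ]; omega) ?_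
    | refine steps_jumpLt_neg rfl (by simp only [regs_cons_zero, regs_cons_succ]; omega) ?_
    | refine steps_jumpEq_pos rfl rfl ?_
    try simp only [regs_cons_zero, regs_cons_succ, List.set_cons_zero, List.set_cons_succ]

theorem steps_stop_left {w N i r p sp x y : ℕ} {mem : ℕ → ℕ} {out : List ℕ}
    (hN : 8 * (N + 1) ≤ 2 ^ w) (hi : i < N) (hir : i ≤ r) (hr : r < N)
    (hri : ¬ r < 2 * i) :
    Steps w prog 7 (cfg 22 N i i r p sp x y mem out)
      (cfg 52 N i i r p sp (r - i) y mem out) := by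
  repeat'
    first
    | exact Steps.refl _
    | refine steps_jump rfl ?_
    | refine steps_add rfl (by simp) (by simp only [regs_cons_zero, regs_cons_succ]; omega) ?_
    | refine steps_sub rfl (by simp) (by simp only [regs_cons_zero, regs_cons_succ]; omega) ?_
    | refine steps_jumpLt_pos rfl (by simp only [regs_cons_zero, regs_cons_succ]; omega) ?_
    | refine steps_jumpLt_neg rfl (by simp only [regs_cons_zero, regs_cons_succ]; omega) ?_
    | refine steps_jumpEq_pos rfl rfl ?_
    try simp only [regs_cons_zero, regs_cons_succ, List.set_cons_zero, List.set_cons_succ]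

theorem steps_stop_mismatch {w N i r p sp x y : ℕ} {mem : ℕ → ℕ} {out : List ℕ}
    (hN : 8 * (N + 1) ≤ 2 ^ w) (hi : i < N) (hir : i ≤ r) (hr : r < N) (hri : r < 2 * i)
    (he : ¬ mem (i + i - r - 1 + N) = mem (r + N)) :
    Steps w prog 14 (cfg 22 N i i r p sp x y mem out)
      (cfg 52 N i i r p sp (r - i) (mem (r + N)) mem out) := by
  repeat'
    first
    | exact Steps.refl _
    | refine steps_jump rfl ?_
    | refine steps_load rfl (by simp) ?_
    | refine steps_add rfl (by simp) (by simp only [regs_cons_zero, regs_cons_succ]; omega) ?_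
    | refine steps_sub rfl (by simp) (by simp only [regs_cons_zero, regs_cons_succ]; omega) ?_
    | refine steps_jumpLt_pos rfl (by simp only [regs_cons_zero, regs_cons_succ]; omega) ?_
    | refine steps_jumpEq_pos rfl rfl ?_
    | refine steps_jumpEq_neg rfl (by simp only [regs_cons_zero, regs_cons_succ]; omega) ?_
    try simp only [regs_cons_zero, regs_cons_succ, List.set_cons_zero, List.set_cons_succ]

theorem steps_recenter_fresh {w N i c r p sp x y : ℕ} {mem : ℕ → ℕ} {out : List ℕ}
    (hi : i < N) (hc : ¬ c = i) (hir : ¬ i < r) :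
    Steps w prog 7 (cfg 22 N i c r p sp x y mem out)
      (cfg 22 N i i i p sp x y mem out) := by
  repeat'
    first
    | exact Steps.refl _
    | refine steps_jump rfl ?_
    | refine steps_copy rfl (by simp) ?_
    | refine steps_jumpLt_pos rfl (by simp only [regs_cons_zero, regs_cons_succ]; omega) ?_
    | refine steps_jumpLt_neg rfl (by simp only [regs_cons_zero, regs_cons_succ]; omega) ?_
    | refine steps_jumpEq_neg rfl (by simp only [regs_cons_zero, regs_cons_succ]; omega) ?_
    try simp only [regs_cons_zero, regs_cons_succ, List.set_cons_zero, List.set_cons_succ]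

theorem steps_mirror {w N i c r p sp x y : ℕ} {mem : ℕ → ℕ} {out : List ℕ}
    (hN : 8 * (N + 1) ≤ 2 ^ w) (hi : i < N) (hc : c < i) (hir : i < r) (hr : r ≤ 2 * c)
    (hr' : r ≤ N) (hk : mem (c + c - i + 2 * N) < r - i) :
    Steps w prog 9 (cfg 22 N i c r p sp x y mem out)
      (cfg 52 N i c r p sp (mem (c + c - i + 2 * N)) (r - i) mem out) := by
  repeat'
    first
    | exact Steps.refl _
    | refine steps_load rfl (by simp) ?_
    | refine steps_add rfl (by simp) (by simp only [regs_cons_zero, regs_cons_succ]; omega) ?_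
    | refine steps_sub rfl (by simp) (by simp only [regs_cons_zero, regs_cons_succ]; omega) ?_
    | refine steps_jumpLt_pos rfl (by simp only [regs_cons_zero, regs_cons_succ]; omega) ?_
    | refine steps_jumpEq_neg rfl (by simp only [regs_cons_zero, regs_cons_succ]; omega) ?_
    try simp only [regs_cons_zero, regs_cons_succ, List.set_cons_zero, List.set_cons_succ]

theorem steps_recenter {w N i c r p sp x y : ℕ} {mem : ℕ → ℕ} {out : List ℕ}
    (hN : 8 * (N + 1) ≤ 2 ^ w) (hi : i < N) (hc : c < i) (hir : i < r) (hr : r ≤ 2 * c)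
    (hr' : r ≤ N) (hk : ¬ mem (c + c - i + 2 * N) < r - i) :
    Steps w prog 11 (cfg 22 N i c r p sp x y mem out)
      (cfg 22 N i i r p sp (mem (c + c - i + 2 * N)) (r - i) mem out) := by
  repeat'
    first
    | exact Steps.refl _
    | refine steps_jump rfl ?_
    | refine steps_load rfl (by simp) ?_
    | refine steps_copy rfl (by simp) ?_
    | refine steps_add rfl (by simp) (by simp only [regs_cons_zero, regs_cons_succ]; omega) ?_
    | refine steps_sub rfl (by simp) (by simp only [regs_cons_zero, regs_cons_succ]; omega) ?_
    | refine steps_jumpLt_pos rfl (by simp only [regs_cons_zero, regs_cons_succ]; omega) ?_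
    | refine steps_jumpLt_neg rfl (by simp only [regs_cons_zero, regs_cons_succ]; omega) ?_
    | refine steps_jumpEq_neg rfl (by simp only [regs_cons_zero, regs_cons_succ]; omega) ?_
    try simp only [regs_cons_zero, regs_cons_succ, List.set_cons_zero, List.set_cons_succ]

theorem steps_skip_inside {w N i c r p sp x y : ℕ} {mem : ℕ → ℕ} {out : List ℕ}
    (hN : 8 * (N + 1) ≤ 2 ^ w) (hi : i < N) (hp : ¬ p < i) :
    Steps w prog 6 (cfg 52 N i c r p sp x y mem out)
      (cfg 22 N (i + 1) c r p sp x (2 * N + i) (Function.update mem (2 * N + i) x) out) := by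
  repeat'
    first
    | exact Steps.refl _
    | refine steps_jump rfl ?_
    | refine steps_store rfl ?_
    | refine steps_add rfl (by simp) (by simp only [regs_cons_zero, regs_cons_succ]; omega) ?_
    | refine steps_jumpLt_neg rfl (by simp only [regs_cons_zero, regs_cons_succ]; omega) ?_
    try simp only [regs_cons_zero, regs_cons_succ, List.set_cons_zero, List.set_cons_succ]

theorem steps_skip_short {w N i c r p sp x y : ℕ} {mem : ℕ → ℕ} {out : List ℕ}
    (hN : 8 * (N + 1) ≤ 2 ^ w) (hi : i < N) (hp : p < i) (hk : p + x < i) :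
    Steps w prog 7 (cfg 52 N i c r p sp x y mem out)
      (cfg 22 N (i + 1) c r p sp x (p + x) (Function.update mem (2 * N + i) x) out) := by
  repeat'
    first
    | exact Steps.refl _
    | refine steps_jump rfl ?_
    | refine steps_store rfl ?_
    | refine steps_add rfl (by simp) (by simp only [regs_cons_zero, regs_cons_succ]; omega) ?_
    | refine steps_jumpLt_pos rfl (by simp only [regs_cons_zero, regs_cons_succ]; omega) ?_
    try simp only [regs_cons_zero, regs_cons_succ, List.set_cons_zero, List.set_cons_succ]

theorem steps_emit {w N i c r p sp x y : ℕ} {mem : ℕ → ℕ} {out : List ℕ}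
    (hN : 8 * (N + 1) ≤ 2 ^ w) (hi : i < N) (hp : p < i) (hk : ¬ p + x < i) (hki : x ≤ i)
    (hsp : sp ≤ 4 * N) :
    Steps w prog 12 (cfg 52 N i c r p sp x y mem out)
      (cfg 22 N (i + 1) c r (i + (i - p)) (sp + 1) x (i - p)
        (Function.update (Function.update mem (2 * N + i) x) sp (i - p)) (out ++ [i - p])) := by
  repeat'
    first
    | exact Steps.refl _
    | refine steps_jump rfl ?_
    | refine steps_write rfl ?_
    | refine steps_store rfl ?_
    | refine steps_add rfl (by simp) (by simp only [regs_cons_zero, regs_cons_succ]; omega) ?_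
    | refine steps_sub rfl (by simp) (by simp only [regs_cons_zero, regs_cons_succ]; omega) ?_
    | refine steps_jumpLt_pos rfl (by simp only [regs_cons_zero, regs_cons_succ]; omega) ?_
    | refine steps_jumpLt_neg rfl (by simp only [regs_cons_zero, regs_cons_succ]; omega) ?_
    try simp only [regs_cons_zero, regs_cons_succ, List.set_cons_zero, List.set_cons_succ]

theorem steps_write_center {w N i c r p sp x y : ℕ} {mem : ℕ → ℕ} {out : List ℕ}
    (hN : 8 * (N + 1) ≤ 2 ^ w) (hi : ¬ i < N) (hp : p ≤ N) :
    Steps w prog 4 (cfg 22 N i c r p sp x y mem out)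
      (cfg 67 N i c r p sp (N - p) y mem (out ++ [N - p])) := by
  repeat'
    first
    | exact Steps.refl _
    | refine steps_jump rfl ?_
    | refine steps_write rfl ?_
    | refine steps_sub rfl (by simp) (by simp only [regs_cons_zero, regs_cons_succ]; omega) ?_
    | refine steps_jumpLt_neg rfl (by simp only [regs_cons_zero, regs_cons_succ]; omega) ?_
    try simp only [regs_cons_zero, regs_cons_succ, List.set_cons_zero, List.set_cons_succ]

theorem steps_pop {w N i c r p sp x y : ℕ} {mem : ℕ → ℕ} {out : List ℕ}
    (hN : 8 * (N + 1) ≤ 2 ^ w) (hsp : 3 * N < sp) (hsp' : sp ≤ 4 * N) :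
    Steps w prog 5 (cfg 67 N i c r p sp x y mem out)
      (cfg 67 N i c r p (sp - 1) (mem (sp - 1)) y mem (out ++ [mem (sp - 1)])) := by
  repeat'
    first
    | exact Steps.refl _
    | refine steps_jump rfl ?_
    | refine steps_write rfl ?_
    | refine steps_load rfl (by simp) ?_
    | refine steps_sub rfl (by simp) (by simp only [regs_cons_zero, regs_cons_succ]; omega) ?_
    | refine steps_jumpLt_pos rfl (by simp only [regs_cons_zero, regs_cons_succ]; omega) ?_
    try simp only [regs_cons_zero, regs_cons_succ, List.set_cons_zero, List.set_cons_succ]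

theorem steps_pop_done {w N i c r p x y : ℕ} {mem : ℕ → ℕ} {out : List ℕ} :
    Steps w prog 1 (cfg 67 N i c r p (3 * N) x y mem out)
      (cfg 68 N i c r p (3 * N) x y mem out) :=
  steps_jumpLt_neg rfl (lt_irrefl (3 * N)) (Steps.refl _)

/-! ### Zipping the input -/

/-- A configuration of `prog` while the input is being zipped. -/
def zipCfg (pc N lo hi d x : ℕ) (mem : ℕ → ℕ) : Config :=
  ⟨pc, regs [N, lo, hi, d, 0, 0, x, 0, 1, 0, 0], mem, []⟩

theorem steps_zip_two {w N lo hi d x : ℕ} {mem : ℕ → ℕ}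
    (hN : 8 * (N + 1) ≤ 2 ^ w) (hlo : lo + 1 < hi) (hhi : hi ≤ N) (hd : d ≤ 2 * N) :
    Steps w prog 11 (zipCfg 3 N lo hi d x mem)
      (zipCfg 3 N (lo + 1) (hi - 1) (d + 1 + 1) (Function.update mem d (mem lo) (hi - 1))
        (Function.update (Function.update mem d (mem lo)) (d + 1)
        (Function.update mem d (mem lo) (hi - 1)))) := by
  repeat'
    first
    | exact Steps.refl _
    | refine steps_jump rfl ?_
    | refine steps_load rfl (by simp) ?_
    | refine steps_store rfl ?_
    | refine steps_add rfl (by simp) (by simp only [regs_cons_zero, regs_cons_succ]; omega) ?_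
    | refine steps_sub rfl (by simp) (by simp only [regs_cons_zero, regs_cons_succ]; omega) ?_
    | refine steps_jumpLt_pos rfl (by simp only [regs_cons_zero, regs_cons_succ]; omega) ?_
    try simp only [regs_cons_zero, regs_cons_succ, List.set_cons_zero, List.set_cons_succ]

theorem steps_zip_one {w N lo hi d x : ℕ} {mem : ℕ → ℕ}
    (hN : 8 * (N + 1) ≤ 2 ^ w) (hlo : lo < hi) (hlo' : ¬ lo + 1 < hi) (hhi : hi ≤ N)
    (hd : d ≤ 2 * N) :
    Steps w prog 7 (zipCfg 3 N lo hi d x mem)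
      (zipCfg 16 N (lo + 1) hi (d + 1) (mem lo) (Function.update mem d (mem lo))) := by
  repeat'
    first
    | exact Steps.refl _
    | refine steps_jump rfl ?_
    | refine steps_load rfl (by simp) ?_
    | refine steps_store rfl ?_
    | refine steps_add rfl (by simp) (by simp only [regs_cons_zero, regs_cons_succ]; omega) ?_
    | refine steps_jumpLt_pos rfl (by simp only [regs_cons_zero, regs_cons_succ]; omega) ?_
    | refine steps_jumpLt_neg rfl (by simp only [regs_cons_zero, regs_cons_succ]; omega) ?_
    try simp only [regs_cons_zero, regs_cons_succ, List.set_cons_zero, List.set_cons_succ]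

theorem steps_zip_zero {w N lo hi d x : ℕ} {mem : ℕ → ℕ}
    (hlo : ¬ lo < hi) :
    Steps w prog 2 (zipCfg 3 N lo hi d x mem)
      (zipCfg 16 N lo hi d x mem) := by
  repeat'
    first
    | exact Steps.refl _
    | refine steps_jump rfl ?_
    | refine steps_jumpLt_neg rfl (by simp only [regs_cons_zero, regs_cons_succ]; omega) ?_
    try simp only [regs_cons_zero, regs_cons_succ, List.set_cons_zero, List.set_cons_succ]

theorem steps_scan_start {w N lo hi d x : ℕ} {mem : ℕ → ℕ}
    (hN : 8 * (N + 1) ≤ 2 ^ w) :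
    Steps w prog 6 (zipCfg 16 N lo hi d x mem)
      (cfg 22 N 1 1 1 0 (3 * N) x 0 mem []) := by
  rw [cfg, show 3 * N = N + N + N by omega, show 2 * N = N + N by omega]
  repeat'
    first
    | exact Steps.refl _
    | refine steps_const rfl (by simp) (by omega) ?_
    | refine steps_copy rfl (by simp) ?_
    | refine steps_add rfl (by simp) (by simp only [regs_cons_zero, regs_cons_succ]; omega) ?_
    try simp only [regs_cons_zero, regs_cons_succ, List.set_cons_zero, List.set_cons_succ]

theorem steps_zip_start {w N : ℕ} {mem : ℕ → ℕ}
    (hN : 8 * (N + 1) ≤ 2 ^ w) :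
    Steps w prog 3 (⟨0, regs [N, 0, 0, 0, 0, 0, 0, 0, 0, 0, 0], mem, []⟩)
      (zipCfg 3 N 0 N N 0 mem) := by
  repeat'
    first
    | exact Steps.refl _
    | refine steps_const rfl (by simp) (by omega) ?_
    | refine steps_copy rfl (by simp) ?_
    try simp only [regs_cons_zero, List.set_cons_zero, List.set_cons_succ]

/-- The memory after `j` characters of the zipped string have been written. -/
structure ZipInv (T : List ℕ) (j : ℕ) (mem : ℕ → ℕ) : Prop where
  input : ∀ e < T.length, mem e = T.getD e 0
  zipped : ∀ e < j, mem (T.length + e) = zipped T e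

theorem ZipInv.update {T : List ℕ} {j v : ℕ} {mem : ℕ → ℕ} (h : ZipInv T j mem)
    (hv : v = _root_.zipped T j) : ZipInv T (j + 1) (Function.update mem (T.length + j) v) := by
  refine ⟨fun e he => ?_, fun e he => ?_⟩
  · rw [Function.update_of_ne (by omega), h.input e he]
  · by_cases hej : e = j
    · subst hej; rw [Function.update_self, hv]
    · rw [Function.update_of_ne (by omega), h.zipped e (by omega)]

theorem exists_steps_zip {w : ℕ} {T : List ℕ} (hN : 8 * (T.length + 1) ≤ 2 ^ w)
    {mem : ℕ → ℕ} (hmem : ZipInv T 0 mem) :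
    ∃ t lo hi d x mem', t ≤ 11 * T.length + 7 ∧
      Steps w prog t (zipCfg 3 T.length 0 T.length T.length 0 mem)
        (zipCfg 16 T.length lo hi d x mem') ∧ ZipInv T T.length mem' := by
  set N := T.length with hNdef
  obtain ⟨t, s, ht, hs, u, lo, hi, d, x, mem', hu, hsu, hz⟩ := exists_steps_of_loop
    (w := w) (P := prog) (K := 11)
    (Inv := fun m s => ∃ lo hi d x mem', s = zipCfg 3 N lo hi d x mem' ∧ m = hi - lo ∧
      hi + lo = N ∧ d = N + 2 * lo ∧ ZipInv T (2 * lo) mem')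
    (Post := fun s => ∃ u lo hi d x mem', u ≤ 7 ∧ Steps w prog u s (zipCfg 16 N lo hi d x mem') ∧
      ZipInv T N mem')
    (m := N) (s := zipCfg 3 N 0 N N 0 mem)
    (by
      rintro m s ⟨lo, hi, d, x, mem', rfl, rfl, hlh, rfl, hz⟩
      by_cases h0 : lo < hi
      · have hz1 : ZipInv T (2 * lo + 1) (Function.update mem' (N + 2 * lo) (mem' lo)) :=
          hz.update (by rw [hz.input lo (by omega), zipped_even])
        by_cases h1 : lo + 1 < hi
        · refine Or.inr ⟨11, _, hi - 1 - (lo + 1), le_rfl,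
            steps_zip_two hN h1 (by omega) (by omega),
            ⟨_, _, _, _, _, rfl, rfl, by omega, by omega, ?_⟩, by omega⟩
          refine hz1.update ?_
          rw [hz1.input _ (by omega), zipped_odd]
          congr 1
          omega
        -- Odd length: only the middle character is left.
        · refine Or.inl ⟨7, _, _, _, _, _, le_rfl,
            steps_zip_one hN h0 h1 (by omega) (by omega), ?_⟩
          rwa [show N = 2 * lo + 1 by omega] at hz1 ⊢
      · refine Or.inl ⟨2, _, _, _, _, _, by omega, steps_zip_zero h0, hz.input,
          fun e he => hz.zipped e (by omega)⟩)
    ⟨0, N, N, 0, mem, rfl, by omega, by omega, by omega, hmem⟩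
  exact ⟨t + u, lo, hi, d, x, mem', by omega, hs.trans hsu, hz⟩

/-! ### Invariant of the scan -/

/-- The invariant of the main loop: `i` is the current center, `c` a center whose palindrome
reaches at least up to `r`, and `L` are the lengths of the blocks split off so far. -/
structure ScanInv (T : List ℕ) (i c r q : ℕ) (L : List ℕ) (mem : ℕ → ℕ) : Prop where
  one_le : 1 ≤ c
  le : c ≤ i
  le_right : c ≤ r
  right_le : r ≤ 2 * c
  right_le_length : i < T.length → r ≤ T.length
  pal : EvenPal (zipped T) c (r - c)
  peeled : ∃ f, Peeled T q L f
  zipped : ∀ e < T.length, mem (T.length + e) = zipped T e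
  radius : ∀ j, 1 ≤ j → j < i → IsRadius (_root_.zipped T) T.length j (mem (2 * T.length + j))
  stack : ∀ e < L.length, mem (3 * T.length + e) = L.getD e 0
  not_pal : ∀ j, 2 * q < j → j < i → 2 * j ≤ T.length + 2 * q →
    ¬ EvenPal (_root_.zipped T) j (j - 2 * q)

namespace ScanInv

variable {T : List ℕ} {i c r q k : ℕ} {L : List ℕ} {mem : ℕ → ℕ}

theorem length_le (h : ScanInv T i c r q L mem) : L.length ≤ q ∧ 2 * q ≤ T.length := by
  obtain ⟨f, hf⟩ := h.peeled
  have := hf.length_le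
  have := hf.length_word
  omega

/-- No block is found at `i`, either because `i` does not lie beyond the offset `2q` or because its
maximal palindrome does not reach back to it. -/
theorem skip (h : ScanInv T i c r q L mem) (hi : i < T.length)
    (hk : IsRadius (_root_.zipped T) T.length i k) (hq : 2 * q < i → 2 * q + k < i) :
    ScanInv T (i + 1) c r q L (Function.update mem (2 * T.length + i) k) where
  one_le := h.one_le
  le := h.le.trans (Nat.le_succ i)
  le_right := h.le_right
  right_le := h.right_le
  right_le_length := fun _ => h.right_le_length hi
  pal := h.pal
  peeled := h.peeled
  zipped := fun e he => by rw [Function.update_of_ne (by omega), h.zipped e he]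
  radius := fun j h1 h2 => by
    by_cases hj : j = i
    · subst hj; rwa [Function.update_self]
    · rw [Function.update_of_ne (by omega)]
      exact h.radius j h1 (by omega)
  stack := fun e he => by rw [Function.update_of_ne (by omega), h.stack e he]
  not_pal := fun j h1 h2 h3 hp => by
    by_cases hj : j = i
    · subst hj
      have := hk.le_of_evenPal hp (by omega) (by omega)
      have := hq h1
      omega
    · exact h.not_pal j h1 (by omega) h3 hp

/-- The palindrome at `i`, cut down to start at `2q`, gives a border; `not_pal` for the earlier
centers makes it the shortest one. -/
theorem emit (h : ScanInv T i c r q L mem) (hi : i < T.length)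
    (hk : IsRadius (_root_.zipped T) T.length i k) (hq : 2 * q < i) (hqk : i ≤ 2 * q + k) :
    ScanInv T (i + 1) c r (q + (i - 2 * q)) (L ++ [i - 2 * q])
      (Function.update (Function.update mem (2 * T.length + i) k) (3 * T.length + L.length)
        (i - 2 * q)) where
  one_le := h.one_le
  le := h.le.trans (Nat.le_succ i)
  le_right := h.le_right
  right_le := h.right_le
  right_le_length := fun _ => h.right_le_length hi
  pal := h.pal
  peeled := by
    obtain ⟨f, hf⟩ := h.peeled
    have := hk.add_le
    refine hf.split (by omega) (by omega) ?_ fun l hl hli hp => ?_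
    · rw [show 2 * q + (i - 2 * q) = i by omega]
      exact hk.pal.mono (by omega)
    · refine h.not_pal (2 * q + l) (by omega) (by omega) (by omega) ?_
      rwa [Nat.add_sub_cancel_left]
  zipped := fun e he => by
    rw [Function.update_of_ne (by omega), Function.update_of_ne (by omega), h.zipped e he]
  radius := fun j h1 h2 => by
    rw [Function.update_of_ne (by omega)]
    by_cases hj : j = i
    · subst hj; rwa [Function.update_self]
    · rw [Function.update_of_ne (by omega)]
      exact h.radius j h1 (by omega)
  stack := fun e he => by
    rw [List.length_append, List.length_singleton] at he
    by_cases hL : e = L.length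
    · subst hL
      rw [Function.update_self, List.getD_append_right _ _ _ _ le_rfl]
      simp
    · rw [Function.update_of_ne (by omega), Function.update_of_ne (by omega), h.stack e (by omega),
        List.getD_append _ _ _ _ (by omega)]
  -- The new offset `2(i - q)` exceeds `i`, so no center lies between the two.
  not_pal := fun j h1 h2 _ _ => by omega

theorem expand (h : ScanInv T i i r q L mem) (hr : r < T.length)
    (hri : r < 2 * i) (he : mem (i + i - r - 1 + T.length) = mem (r + T.length)) :
    ScanInv T i i (r + 1) q L mem where
  one_le := h.one_le
  le := h.le
  le_right := by have := h.le_right; omega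
  right_le := hri
  right_le_length := fun _ => hr
  pal := by
    have h1 := h.le_right
    rw [show r + 1 - i = r - i + 1 by omega]
    refine h.pal.succ ?_
    rw [Nat.add_comm _ T.length, Nat.add_comm r, h.zipped _ (by omega), h.zipped _ hr] at he
    rw [show i + (r - i) = r by omega, show i - 1 - (r - i) = i + i - r - 1 by omega, he]
  peeled := h.peeled
  zipped := h.zipped
  radius := h.radius
  stack := h.stack
  not_pal := h.not_pal

theorem isRadius_self (h : ScanInv T i i r q L mem) (hi : i < T.length)
    (he : r < T.length → r < 2 * i → mem (i + i - r - 1 + T.length) ≠ mem (r + T.length)) :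
    IsRadius (_root_.zipped T) T.length i (r - i) := by
  have h1 := h.le_right
  have h2 := h.right_le
  have h3 := h.right_le_length hi
  refine ⟨by omega, by omega, h.pal, fun h4 h5 h6 => he (by omega) (by omega) ?_⟩
  rw [Nat.add_comm _ T.length, Nat.add_comm r, h.zipped _ (by omega), h.zipped _ (by omega)]
  rw [show i + (r - i) = r by omega, show i - 1 - (r - i) = i + i - r - 1 by omega] at h6
  exact h6.symm

theorem isRadius_mirror (h : ScanInv T i c r q L mem) (hci : c < i) (hir : i < r) :
    IsRadius (_root_.zipped T) T.length (2 * c - i) (mem (c + c - i + 2 * T.length)) := by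
  have h2 := h.right_le
  have := h.radius (2 * c - i) (by omega) (by omega)
  rwa [show 2 * T.length + (2 * c - i) = c + c - i + 2 * T.length by omega] at this

theorem isRadius_copy (h : ScanInv T i c r q L mem) (hi : i < T.length) (hci : c < i)
    (hir : i < r) (hk : mem (c + c - i + 2 * T.length) < r - i) :
    IsRadius (_root_.zipped T) T.length i (mem (c + c - i + 2 * T.length)) := by
  have h2 := h.right_le
  have h3 := h.right_le_length hi
  exact IsRadius.of_mirror h.pal (by omega) (by omega) hci.le (h.isRadius_mirror hci hir)
    (by omega)

/-- The mirrored palindrome reaches the edge of the window, so the one at `i` reaches `r`. Nothing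
is known beyond `r`, and extension resumes there with `i` as center. -/
theorem recenter (h : ScanInv T i c r q L mem) (hci : c < i)
    (hir : i < r)
    (hk : ¬ mem (c + c - i + 2 * T.length) < r - i) :
    ScanInv T i i r q L mem where
  one_le := by have := h.one_le; omega
  le := le_rfl
  le_right := hir.le
  right_le := by have := h.right_le; omega
  right_le_length := h.right_le_length
  pal := by
    have h2 := h.right_le
    have h4 := h.isRadius_mirror hci hir
    exact h.pal.of_mirror (by omega) hci.le (h4.pal.mono (by omega)) (by omega) (by omega)
  peeled := h.peeled
  zipped := h.zipped
  radius := h.radius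
  stack := h.stack
  not_pal := h.not_pal

theorem recenter_fresh (h : ScanInv T i c r q L mem) :
    ScanInv T i i i q L mem where
  one_le := h.one_le.trans h.le
  le := le_rfl
  le_right := le_rfl
  right_le := by omega
  right_le_length := fun hi => hi.le
  pal := fun d hd => by omega
  peeled := h.peeled
  zipped := h.zipped
  radius := h.radius
  stack := h.stack
  not_pal := h.not_pal

end ScanInv

/-! ### Running time and correctness -/

/-- The configurations at the head of the main loop. -/
def AtScan (T : List ℕ) (m : ℕ) (s : Config) : Prop :=
  ∃ i c r q x y L mem,
    s = cfg 22 T.length i c r (2 * q) (3 * T.length + L.length) x y mem L ∧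
    ScanInv T i c r q L mem ∧
    -- Potential: a successful comparison advances `r`, recentering clears the last term without
    -- lowering `r`, and recording a radius advances `i`, whose weight 2 pays for the last term
    -- becoming 1.
    m = 2 * (T.length - i) + (T.length - r) + if c = i then 0 else 1

theorem exists_steps_record {w : ℕ} {T : List ℕ} (hN : 8 * (T.length + 1) ≤ 2 ^ w)
    {i c r q k y : ℕ} {L : List ℕ} {mem : ℕ → ℕ} (h : ScanInv T i c r q L mem)
    (hi : i < T.length) (hk : IsRadius (zipped T) T.length i k) :
    ∃ t s m, t ≤ 12 ∧
      Steps w prog t (cfg 52 T.length i c r (2 * q) (3 * T.length + L.length) k y mem L) s ∧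
      AtScan T m s ∧ m < 2 * (T.length - i) + (T.length - r) := by
  have hm : 2 * (T.length - (i + 1)) + (T.length - r) + (if c = i + 1 then 0 else 1) <
      2 * (T.length - i) + (T.length - r) := by
    split_ifs <;> omega
  have hL := h.length_le
  by_cases hp : 2 * q < i
  · by_cases hqk : 2 * q + k < i
    · exact ⟨7, _, _, by omega, steps_skip_short hN hi hp hqk,
        ⟨_, _, _, _, _, _, _, _, rfl, h.skip hi hk fun _ => hqk, rfl⟩, hm⟩
    · refine ⟨12, _, _, le_rfl, steps_emit hN hi hp hqk hk.le (by omega),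
        ⟨i + 1, c, r, q + (i - 2 * q), k, i - 2 * q, L ++ [i - 2 * q], _, ?_,
          h.emit hi hk hp (by omega), rfl⟩, hm⟩
      rw [show i + (i - 2 * q) = 2 * (q + (i - 2 * q)) by omega, List.length_append,
        List.length_singleton, Nat.add_assoc]
  · exact ⟨6, _, _, by omega, steps_skip_inside hN hi hp,
      ⟨_, _, _, _, _, _, _, _, rfl, h.skip hi hk fun h => absurd h hp, rfl⟩, hm⟩

theorem exists_steps_round {w : ℕ} {T : List ℕ} (hN : 8 * (T.length + 1) ≤ 2 ^ w)
    {i c r q x y : ℕ} {L : List ℕ} {mem : ℕ → ℕ} (h : ScanInv T i c r q L mem)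
    (hi : i < T.length) :
    ∃ t s m, t ≤ 26 ∧
      Steps w prog t (cfg 22 T.length i c r (2 * q) (3 * T.length + L.length) x y mem L) s ∧
      AtScan T m s ∧
      m < 2 * (T.length - i) + (T.length - r) + if c = i then 0 else 1 := by
  have hr := h.right_le_length hi
  have hir := h.le_right
  have hr2 := h.right_le
  by_cases hc : c = i
  · subst hc
    rw [if_pos rfl, Nat.add_zero]
    -- Common ending when extension stops at the right end, at the left end or at a mismatch; in
    -- each case `r - c` is the radius.
    have finish : ∀ {u y'}, u ≤ 14 →
        Steps w prog u (cfg 22 T.length c c r (2 * q) (3 * T.length + L.length) x y mem L)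
          (cfg 52 T.length c c r (2 * q) (3 * T.length + L.length) (r - c) y' mem L) →
        (r < T.length → r < 2 * c → mem (c + c - r - 1 + T.length) ≠ mem (r + T.length)) →
        ∃ t s m, t ≤ 26 ∧
          Steps w prog t (cfg 22 T.length c c r (2 * q) (3 * T.length + L.length) x y mem L) s ∧
          AtScan T m s ∧ m < 2 * (T.length - c) + (T.length - r) := by
      intro u y' hu hsu hne
      obtain ⟨t, s, m, ht, hst, hs, hm⟩ :=
        exists_steps_record (y := y') hN h hi (h.isRadius_self hi hne)
      exact ⟨u + t, s, m, by omega, hsu.trans hst, hs, hm⟩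
    by_cases h1 : r < T.length
    · by_cases h2 : r < 2 * c
      · by_cases he : mem (c + c - r - 1 + T.length) = mem (r + T.length)
        · refine ⟨14, _, _, by omega, steps_expand hN hi hir h1 h2 he,
            ⟨_, _, _, _, _, _, _, _, rfl, h.expand h1 h2 he, rfl⟩, ?_⟩
          rw [if_pos rfl]
          omega
        · exact finish le_rfl (steps_stop_mismatch hN hi hir h1 h2 he) fun _ _ => he
      · exact finish (by omega) (steps_stop_left hN hi hir h1 h2) fun _ h => absurd h h2
    · exact finish (by omega) (steps_stop_right hN hi hir h1 hr2) fun h => absurd h h1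
  · have hci : c < i := lt_of_le_of_ne h.le hc
    rw [if_neg hc]
    by_cases h1 : i < r
    · by_cases hk : mem (c + c - i + 2 * T.length) < r - i
      · obtain ⟨t, s, m, ht, hst, hs, hm⟩ :=
          exists_steps_record (y := r - i) hN h hi (h.isRadius_copy hi hci h1 hk)
        exact ⟨9 + t, s, m, by omega, (steps_mirror hN hi hci h1 hr2 hr hk).trans hst, hs,
          by omega⟩
      · refine ⟨11, _, _, by omega, steps_recenter hN hi hci h1 hr2 hr hk,
          ⟨_, _, _, _, _, _, _, _, rfl, h.recenter hci h1 hk, rfl⟩, ?_⟩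
        rw [if_pos rfl]
        omega
    · refine ⟨7, _, _, by omega, steps_recenter_fresh hi hc h1,
        ⟨_, _, _, _, _, _, _, _, rfl, h.recenter_fresh, rfl⟩, ?_⟩
      rw [if_pos rfl]
      omega

theorem exists_steps_pop {w N p i c r x y : ℕ} (hN : 8 * (N + 1) ≤ 2 ^ w) {L : List ℕ}
    (hL : L.length ≤ N) {mem : ℕ → ℕ} (hmem : ∀ e < L.length, mem (3 * N + e) = L.getD e 0)
    (out : List ℕ) :
    ∃ t s, t ≤ 5 * L.length + 1 ∧
      Steps w prog t (cfg 67 N i c r p (3 * N + L.length) x y mem out) s ∧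
      step w prog s = none ∧ s.output = out ++ L.reverse := by
  obtain ⟨t, s, ht, hst, x', rfl⟩ := exists_steps_of_loop (w := w) (P := prog) (K := 5)
    (Inv := fun m s => ∃ x, m ≤ L.length ∧
      s = cfg 67 N i c r p (3 * N + m) x y mem (out ++ (L.drop m).reverse))
    (Post := fun s => ∃ x, s = cfg 67 N i c r p (3 * N) x y mem (out ++ L.reverse))
    (m := L.length) (s := cfg 67 N i c r p (3 * N + L.length) x y mem out)
    (by
      rintro m s ⟨x, hm, rfl⟩
      rcases m with _ | m
      · exact Or.inl ⟨x, rfl⟩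
      · refine Or.inr ⟨5, _, m, le_rfl, steps_pop hN (by omega) (by omega),
          ⟨mem (3 * N + (m + 1) - 1), by omega, ?_⟩,
          by omega⟩
        rw [show 3 * N + (m + 1) - 1 = 3 * N + m by omega, hmem m (by omega),
          List.getD_eq_getElem _ _ (by omega), List.drop_eq_getElem_cons (i := m) (by omega),
          List.reverse_cons, List.append_assoc])
    ⟨x, le_rfl, by simp⟩
  exact ⟨t + 1, _, by omega, hst.trans steps_pop_done, rfl, rfl⟩

theorem init_eq (T : List ℕ) :
    init T = ⟨0, regs [T.length, 0, 0, 0, 0, 0, 0, 0, 0, 0, 0], fun e => T.getD e 0, []⟩ := by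
  simp only [init, Config.mk.injEq, true_and, and_true]
  funext r
  rcases r with _ | r
  · rfl
  · rw [regs_cons_succ, if_neg (by omega), regs, List.getD_eq_getElem?_getD]
    by_cases hr : r < 10
    · interval_cases r <;> rfl
    · rw [List.getElem?_eq_none (by simp; omega)]
      rfl

/-- The factor 8 leaves ample room for all addresses and sums of addresses. The time is at most
`11N` for zipping, `26 · 3N` for scanning, `5N / 2` for unwinding, and a constant. -/
theorem exists_computes (w : ℕ) (T : List ℕ) (hN : 8 * (T.length + 1) ≤ 2 ^ w) :
    ∃ (f : BlockPalindrome ℕ) (t : ℕ), f.IsLargest T ∧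
      Computes w prog T t (f.blocks.map List.length) ∧ t ≤ 100 * (T.length + 1) := by
  obtain ⟨t₁, lo, hi, d, x, mem₁, ht₁, hs₁, hz⟩ := exists_steps_zip hN
    (mem := fun e => T.getD e 0) ⟨fun _ _ => rfl, fun _ h => absurd h (Nat.not_lt_zero _)⟩
  have hscan : AtScan T (2 * (T.length - 1) + (T.length - 1) + if 1 = 1 then 0 else 1)
      (cfg 22 T.length 1 1 1 0 (3 * T.length) x 0 mem₁ []) :=
    ⟨1, 1, 1, 0, x, 0, [], mem₁, rfl,
      { one_le := le_rfl
        le := le_rfl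
        le_right := le_rfl
        right_le := by omega
        -- For the empty string the initial `r = 1` exceeds the length, hence the guard in this
        -- field.
        right_le_length := fun h => h.le
        pal := fun d hd => by omega
        peeled := ⟨_, peeled_single T⟩
        zipped := hz.zipped
        radius := fun j h1 h2 => by omega
        stack := fun e he => absurd he (Nat.not_lt_zero e)
        not_pal := fun j h1 h2 => by omega }, rfl⟩
  obtain ⟨t₂, s₂, ht₂, hs₂, i, c, r, q, x₂, y₂, L, mem₂, rfl, hinv, hi₂⟩ :=
    exists_steps_of_loop (w := w) (P := prog) (K := 26) (Inv := AtScan T)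
      (Post := fun s => ∃ i c r q x y L mem,
        s = cfg 22 T.length i c r (2 * q) (3 * T.length + L.length) x y mem L ∧
        ScanInv T i c r q L mem ∧ ¬ i < T.length)
      (by
        rintro m s ⟨i, c, r, q, x, y, L, mem, rfl, h, rfl⟩
        by_cases hi : i < T.length
        · exact Or.inr (exists_steps_round hN h hi)
        · exact Or.inl ⟨i, c, r, q, x, y, L, mem, rfl, h, hi⟩) hscan
  obtain ⟨f, hf⟩ := hinv.peeled
  have hlen := hinv.length_le
  have hgreedy : f.IsGreedy := by
    -- The scan ended with `i ≥ N`, so every center whose palindrome could start at `2q` has been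
    -- examined.
    refine hf.isGreedy fun l hl hlT hp => hinv.not_pal (2 * q + l) (by omega) (by omega)
      (by omega) ?_
    rwa [Nat.add_sub_cancel_left]
  obtain ⟨t₃, s₃, ht₃, hs₃, hhalt, hout⟩ := exists_steps_pop (p := 2 * q) (i := i) (c := c)
    (r := r) (x := T.length - 2 * q) (y := y₂) hN (by omega) hinv.stack
    (L ++ [T.length - 2 * q])
  refine ⟨f, 3 + (t₁ + (6 + (t₂ + (4 + t₃)))), hf.word_eq ▸ hgreedy.isLargest,
    ⟨s₃, ?_, hhalt, ?_⟩, ?_⟩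
  · rw [init_eq]
    exact (steps_zip_start hN).trans (hs₁.trans ((steps_scan_start hN).trans
      (hs₂.trans ((steps_write_center hN hi₂ hlen.2).trans hs₃))))
  · rw [hout, hf.map_length_blocks, List.append_assoc, List.singleton_append]
  · rw [if_pos rfl] at ht₂
    omega

end WordRAM

theorem theorem1 :
    (∀ T : List ℕ,
      (∃! f : BlockPalindrome ℕ, f.IsLargest T) ∧
      ∀ f : BlockPalindrome ℕ, f.word = T → (f.IsLargest T ↔ f.IsGreedy)) ∧
    ∃ (P : List WordRAM.Instr) (a C : ℕ), ∀ (w : ℕ) (T : List ℕ),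
      a * (T.length + 1) ≤ 2 ^ w → (∀ c ∈ T, c < 2 ^ w) →
      ∃ (f : BlockPalindrome ℕ) (t : ℕ), f.IsLargest T ∧
        WordRAM.Computes w P T t (f.blocks.map List.length) ∧ t ≤ C * (T.length + 1) :=
  ⟨fun T => ⟨BlockPalindrome.existsUnique_isLargest T,
      fun _ hf => BlockPalindrome.isLargest_iff_isGreedy hf⟩,
    WordRAM.prog, 8, 100, fun w T hN _ => WordRAM.exists_computes w T hN⟩
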